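/- Let $p,q\ge 1$ be integers and $n=p+q+1$. Let $\mathrm{Poly}_n(\mathbb{C})[p,q]$ be the space of monic square-free polynomials of degree $n$ over $\mathbb{C}$ that have exactly two distinct critical points, one of multiplicity $p$ and the other of multiplicity $q$ (that is, $g'(z)=n(z-a)^p(z-b)^q$ for some $a\neq b$), with the topology given by the coefficients. Put $$f(z)=n\int_0^z u^p(u-1)^q\,du,\qquad \mu=f(1)=n\int_0^1u^p(u-1)^q\,du\neq 0,$$ so that $f-c\in\mathrm{Poly}_n(\mathbb{C})[p,q]$ for every $c\in\mathbb{C}\setminus\{0,\mu\}$, and let $\mathscr{B}_n[p,q]=\pi_1\bigl(\mathrm{Poly}_n(\mathbb{C})[p,q],\,f-\mu/2\bigr)$. Let $x,y\in\mathscr{B}_n[p,q]$ be the classes of the loops $t\mapsto f-\gamma(t)$, $t\in[0,1]$, where $\gamma$ is the counter-clockwise circular loop based at $\mu/2$ around $0$, $\gamma(t)=\tfrac{\mu}{2}e^{2\pi i t}$, respectively around $\mu$, $\gamma(t)=\mu-\tfrac{\mu}{2}e^{2\pi i t}$. Then the subgroup of $\mathscr{B}_n[p,q]$ generated by $x$ and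 $y$ is free of rank $2$, with free basis $x,y$. -/

import Mathlib

open Polynomial

noncomputable section

/-- `Poly_n(ℂ)[p,q]` with `n = p + q + 1`: monic square-free complex polynomials of degree `n` with
exactly two distinct critical points, one of multiplicity `p` and the other of multiplicity `q`. -/
def PolyStratum (p q : ℕ) : Type :=
  {f : ℂ[X] // f.Monic ∧ f.natDegree = p + q + 1 ∧ Squarefree f ∧
    ∃ a b : ℂ, a ≠ b ∧
      derivative f = C ((p + q + 1 : ℕ) : ℂ) * ((X - C a) ^ p * (X - C b) ^ q)}

/-- The topology of the coefficient space `ℂⁿ`: a monic polynomial of degree `n` is identified with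
the vector of its coefficients of `1, z, …, z ^ (n - 1)`. -/
instance PolyStratum.instTopologicalSpace (p q : ℕ) : TopologicalSpace (PolyStratum p q) :=
  TopologicalSpace.induced (fun (f : PolyStratum p q) (i : Fin (p + q + 1)) => f.1.coeff i)
    inferInstance

/-- The integrand `n u ^ p (u - 1) ^ q`, as a polynomial. -/
def baseDeriv (p q : ℕ) : ℂ[X] :=
  C ((p + q + 1 : ℕ) : ℂ) * ((X - C 0) ^ p * (X - C 1) ^ q)

/-- The polynomial `f(z) = n ∫₀ᶻ u ^ p (u - 1) ^ q du`, integrated term by term; see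
`basePoly_eval` for the integral formula. -/
def basePoly (p q : ℕ) : ℂ[X] :=
  ∑ k ∈ Finset.range (p + q + 1), monomial (k + 1) ((baseDeriv p q).coeff k / ((k : ℂ) + 1))

/-- The critical value `μ = n ∫₀¹ u ^ p (u - 1) ^ q du`. -/
def critValue (p q : ℕ) : ℂ :=
  ((p + q + 1 : ℕ) : ℂ) * ∫ u in (0 : ℝ)..1, (u : ℂ) ^ p * ((u : ℂ) - 1) ^ q

theorem baseDeriv_monic_part (p q : ℕ) :
    ((X - C (0 : ℂ)) ^ p * (X - C (1 : ℂ)) ^ q).Monic :=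
  ((monic_X_sub_C _).pow _).mul ((monic_X_sub_C _).pow _)

theorem natDegree_part (p q : ℕ) :
    ((X - C (0 : ℂ)) ^ p * (X - C (1 : ℂ)) ^ q).natDegree = p + q := by
  rw [((monic_X_sub_C (0 : ℂ)).pow p).natDegree_mul ((monic_X_sub_C (1 : ℂ)).pow q),
    natDegree_pow, natDegree_pow, natDegree_X_sub_C, natDegree_X_sub_C, mul_one, mul_one]

theorem natDegree_baseDeriv (p q : ℕ) : (baseDeriv p q).natDegree = p + q := by
  have h : ((p + q + 1 : ℕ) : ℂ) ≠ 0 := Nat.cast_ne_zero.mpr (Nat.succ_ne_zero _)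
  rw [baseDeriv, natDegree_C_mul h, natDegree_part]

theorem derivative_basePoly (p q : ℕ) : derivative (basePoly p q) = baseDeriv p q := by
  have h : (baseDeriv p q).natDegree < p + q + 1 := by rw [natDegree_baseDeriv]; omega
  conv_rhs => rw [(baseDeriv p q).as_sum_range' _ h]
  rw [basePoly, derivative_sum]
  refine Finset.sum_congr rfl fun k _ => ?_
  have hk : (k : ℂ) + 1 ≠ 0 := by exact_mod_cast Nat.succ_ne_zero k
  rw [derivative_monomial, Nat.add_sub_cancel]
  congr 1
  push_cast
  field_simp

theorem basePoly_eval_zero (p q : ℕ) : (basePoly p q).eval 0 = 0 := by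
  rw [basePoly, eval_finsetSum]
  exact Finset.sum_eq_zero fun k _ => by simp [eval_monomial]

/-- The integral along the segment from `0` to `z`. -/
theorem basePoly_eval (p q : ℕ) (z : ℂ) :
    (basePoly p q).eval z =
      ((p + q + 1 : ℕ) : ℂ) * ∫ t in (0 : ℝ)..1, (t * z) ^ p * (t * z - 1) ^ q * z := by
  have hd : ∀ t : ℝ, HasDerivAt (fun t : ℝ => (basePoly p q).eval ((t : ℂ) * z))
      (((p + q + 1 : ℕ) : ℂ) * ((t * z) ^ p * (t * z - 1) ^ q * z)) t := by
    intro t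
    have h1 : HasDerivAt (fun t : ℝ => (t : ℂ) * z) z t := by
      simpa using (HasDerivAt.ofReal_comp (hasDerivAt_id t)).mul_const z
    have h2 := ((basePoly p q).hasDerivAt ((t : ℂ) * z)).comp t h1
    rw [derivative_basePoly] at h2
    refine HasDerivAt.congr_deriv (f := fun t : ℝ => (basePoly p q).eval ((t : ℂ) * z)) h2 ?_
    simp only [baseDeriv, eval_mul, eval_pow, eval_sub, eval_X, eval_C, sub_zero]
    ring
  have h := intervalIntegral.integral_eq_sub_of_hasDerivAt (a := 0) (b := 1)
    (fun t _ => hd t) (Continuous.intervalIntegrable (by fun_prop) _ _)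
  rw [intervalIntegral.integral_const_mul] at h
  rw [h]
  simp [basePoly_eval_zero]

theorem basePoly_eval_one (p q : ℕ) : (basePoly p q).eval 1 = critValue p q := by
  rw [basePoly_eval, critValue]
  simp

theorem critValue_ne_zero (p q : ℕ) : critValue p q ≠ 0 := by
  have hn : ((p + q + 1 : ℕ) : ℂ) ≠ 0 := Nat.cast_ne_zero.mpr (Nat.succ_ne_zero _)
  have hpos : (0 : ℝ) < ∫ u in (0 : ℝ)..1, u ^ p * (1 - u) ^ q := by
    refine intervalIntegral.intervalIntegral_pos_of_pos_on
      (Continuous.intervalIntegrable (by fun_prop) _ _) (fun u hu => ?_) one_pos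
    exact mul_pos (pow_pos hu.1 _) (pow_pos (sub_pos.mpr hu.2) _)
  have heq : (∫ u in (0 : ℝ)..1, (u : ℂ) ^ p * ((u : ℂ) - 1) ^ q) =
      (-1) ^ q * ((∫ u in (0 : ℝ)..1, u ^ p * (1 - u) ^ q : ℝ) : ℂ) := by
    rw [← intervalIntegral.integral_ofReal, ← intervalIntegral.integral_const_mul]
    congr 1
    funext u
    push_cast
    rw [← neg_sub (1 : ℂ) (u : ℂ), neg_pow]
    ring
  rw [critValue, heq]
  refine mul_ne_zero hn (mul_ne_zero (pow_ne_zero _ (neg_ne_zero.mpr one_ne_zero)) ?_)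
  exact_mod_cast hpos.ne'

theorem natDegree_basePoly_sub (p q : ℕ) (c : ℂ) :
    (basePoly p q - C c).natDegree = p + q + 1 := by
  have hd : derivative (basePoly p q - C c) = baseDeriv p q := by
    rw [derivative_sub, derivative_C, sub_zero, derivative_basePoly]
  have h0 : baseDeriv p q ≠ 0 :=
    mul_ne_zero (C_ne_zero.mpr (Nat.cast_ne_zero.mpr (Nat.succ_ne_zero _)))
      (baseDeriv_monic_part p q).ne_zero
  have h1 := natDegree_derivative (basePoly p q - C c)
  rw [hd, natDegree_baseDeriv] at h1
  have h2 : (basePoly p q - C c).natDegree ≠ 0 := fun h => h0 (by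
    rw [← hd, eq_C_of_natDegree_eq_zero h, derivative_C])
  omega

theorem monic_basePoly_sub (p q : ℕ) (c : ℂ) : (basePoly p q - C c).Monic := by
  have hn : ((p : ℂ) + q + 1) ≠ 0 := by exact_mod_cast Nat.succ_ne_zero (p + q)
  have hd : derivative (basePoly p q - C c) = baseDeriv p q := by
    rw [derivative_sub, derivative_C, sub_zero, derivative_basePoly]
  have h1 : (derivative (basePoly p q - C c)).coeff (p + q) = ((p + q + 1 : ℕ) : ℂ) := by
    have := (baseDeriv_monic_part p q).coeff_natDegree
    rw [natDegree_part] at this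
    rw [hd, baseDeriv, coeff_C_mul, this, mul_one]
  rw [coeff_derivative] at h1
  push_cast at h1
  rw [Monic, leadingCoeff, natDegree_basePoly_sub]
  exact mul_right_cancel₀ hn (by rw [h1, one_mul])

theorem squarefree_basePoly_sub (p q : ℕ) {c : ℂ} (h0 : c ≠ 0) (h1 : c ≠ critValue p q) :
    Squarefree (basePoly p q - C c) := by
  have hn : ((p + q + 1 : ℕ) : ℂ) ≠ 0 := Nat.cast_ne_zero.mpr (Nat.succ_ne_zero _)
  have key : ∀ a : ℂ, (basePoly p q).eval a ≠ c → IsCoprime (basePoly p q - C c) (X - C a) := by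
    intro a ha
    refine ((irreducible_X_sub_C a).coprime_iff_not_dvd.mpr fun hdvd => ha ?_).symm
    have := dvd_iff_isRoot.mp hdvd
    rwa [IsRoot, eval_sub, eval_C, sub_eq_zero] at this
  refine Separable.squarefree ?_
  rw [Separable, derivative_sub, derivative_C, sub_zero, derivative_basePoly, baseDeriv]
  refine IsCoprime.mul_right ?_ (IsCoprime.mul_right ?_ ?_)
  · exact ⟨0, C ((p + q + 1 : ℕ) : ℂ)⁻¹, by rw [zero_mul, zero_add, ← C_mul, inv_mul_cancel₀ hn, C_1]⟩
  · exact (key 0 (by rw [basePoly_eval_zero]; exact h0.symm)).pow_right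
  · exact (key 1 (by rw [basePoly_eval_one]; exact h1.symm)).pow_right

/-- The twice punctured plane `ℂ ∖ {0, μ}`. -/
def PuncturedPlane (p q : ℕ) : Type := {c : ℂ // c ≠ 0 ∧ c ≠ critValue p q}

instance PuncturedPlane.instTopologicalSpace (p q : ℕ) : TopologicalSpace (PuncturedPlane p q) :=
  instTopologicalSpaceSubtype

/-- The polynomial `f(z) - c`, for `c ∈ ℂ ∖ {0, μ}`. -/
def shiftedPoly (p q : ℕ) (c : PuncturedPlane p q) : PolyStratum p q :=
  ⟨basePoly p q - C c.1, monic_basePoly_sub p q c.1, natDegree_basePoly_sub p q c.1,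
    squarefree_basePoly_sub p q c.2.1 c.2.2, 0, 1, zero_ne_one, by
      rw [derivative_sub, derivative_C, sub_zero, derivative_basePoly, baseDeriv]⟩

theorem continuous_shiftedPoly (p q : ℕ) : Continuous (shiftedPoly p q) := by
  refine continuous_induced_rng.mpr (continuous_pi fun i => ?_)
  have h : Continuous fun c : PuncturedPlane p q => c.1 := continuous_subtype_val
  simp only [Function.comp_def, shiftedPoly, coeff_sub, coeff_C]
  split_ifs <;> fun_prop

/-- The base point `μ / 2` of the twice punctured plane. -/
def midpt (p q : ℕ) : PuncturedPlane p q :=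
  ⟨critValue p q / 2, div_ne_zero (critValue_ne_zero p q) two_ne_zero, fun h =>
    critValue_ne_zero p q (by linear_combination (-2) * h)⟩

/-- The group `𝓑_n[p,q] = π₁(Poly_n(ℂ)[p,q], f - μ / 2)`. -/
abbrev StratumBraidGroup (p q : ℕ) : Type :=
  FundamentalGroup (PolyStratum p q) (shiftedPoly p q (midpt p q))

theorem norm_half_exp (p q : ℕ) (t : ℝ) :
    ‖critValue p q / 2 * Complex.exp (2 * Real.pi * Complex.I * t)‖ = ‖critValue p q‖ / 2 := by
  have h : (2 * Real.pi * Complex.I * t : ℂ) = ((2 * Real.pi * t : ℝ) : ℂ) * Complex.I := by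
    push_cast; ring
  rw [norm_mul, h, Complex.norm_exp_ofReal_mul_I, mul_one, norm_div, Complex.norm_two]

theorem circle_avoids (p q : ℕ) (t : ℝ) :
    critValue p q / 2 * Complex.exp (2 * Real.pi * Complex.I * t) ≠ 0 ∧
      critValue p q / 2 * Complex.exp (2 * Real.pi * Complex.I * t) ≠ critValue p q := by
  have hpos := norm_pos_iff.mpr (critValue_ne_zero p q)
  have hn := norm_half_exp p q t
  constructor <;> intro h <;> rw [h] at hn
  · rw [norm_zero] at hn; linarith
  · linarith

/-- The counter-clockwise circle `t ↦ (μ / 2) exp(2πit)` around `0`, based at `μ / 2`. -/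
def loopAroundZero (p q : ℕ) : Path (midpt p q) (midpt p q) where
  toFun t := ⟨critValue p q / 2 * Complex.exp (2 * Real.pi * Complex.I * (t : ℝ)),
    circle_avoids p q t⟩
  continuous_toFun := Continuous.subtype_mk (by fun_prop) _
  source' := Subtype.ext (by simp [midpt])
  target' := Subtype.ext (by simp [midpt])

/-- The counter-clockwise circle `t ↦ μ - (μ / 2) exp(2πit)` around `μ`, based at `μ / 2`. -/
def loopAroundMu (p q : ℕ) : Path (midpt p q) (midpt p q) where
  toFun t := ⟨critValue p q - critValue p q / 2 * Complex.exp (2 * Real.pi * Complex.I * (t : ℝ)),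
    fun h => (circle_avoids p q t).2 (sub_eq_zero.mp h).symm,
    fun h => (circle_avoids p q t).1 (sub_eq_self.mp h)⟩
  continuous_toFun := Continuous.subtype_mk (by fun_prop) _
  source' := Subtype.ext (by simp [midpt]; ring)
  target' := Subtype.ext (by simp [midpt]; ring)

/-- The class in `𝓑_n[p,q]` of the loop of polynomials `t ↦ f(z) - γ(t)`. -/
def loopClass (p q : ℕ) (γ : Path (midpt p q) (midpt p q)) : StratumBraidGroup p q :=
  FundamentalGroup.fromPath ⟦γ.map (continuous_shiftedPoly p q)⟧

/-- The element `x` of `𝓑_n[p,q]`. -/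
def elemX (p q : ℕ) : StratumBraidGroup p q := loopClass p q (loopAroundZero p q)

/-- The element `y` of `𝓑_n[p,q]`. -/
def elemY (p q : ℕ) : StratumBraidGroup p q := loopClass p q (loopAroundMu p q)

end

/-! The elements `x` and `y` are the images of two circular loops under the map `c ↦ f - c` from `ℂ
∖ {0, μ}` to the stratum. It suffices that the circles are free in the fundamental group of the
plane and that this map is injective on fundamental groups.

For the plane, a covering with fibre the free group is glued by hand. Its monodromy along the two
circles is left translation by the two generators (`monodromy_loopAroundZero`,
`monodromy_loopAroundMu`), so a word `w` carries `1` to `w`, and a word with trivial image is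
trivial.

For the stratum, a polynomial `g` with critical points `a`, `b` becomes `(b - a)^n (f - c)` after
the substitution `z ↦ (b - a) z + a`, where `c = -g(a) / (b - a)^n`. This would be a retraction onto
the plane, but for `p = q` the order of `a` and `b` is ambiguous and only `(b - a)^2` is a function
of `g`. Along a homotopy of paths the ambiguity disappears: `b - a` is lifted through the squaring
covering (`exists_gap_lift`), it equals `1` on the whole boundary of the square, and `c` is then a
homotopy in the plane (`homotopic_of_map_shiftedPoly`). -/

/-! ### Slit charts of the twice punctured plane -/

/-- The position of a point of `ℂ ∖ {0, μ}` relative to the two punctures, normalized to `0, 1`. -/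
noncomputable def PuncturedPlane.ratio {p q : ℕ} (c : PuncturedPlane p q) : ℂ := c.1 / critValue p q

namespace PuncturedPlane

variable {p q : ℕ}

theorem continuous_ratio : Continuous (ratio : PuncturedPlane p q → ℂ) :=
  (continuous_subtype_val (p := fun c : ℂ => c ≠ 0 ∧ c ≠ critValue p q)).div_const _

theorem ratio_ne_zero (c : PuncturedPlane p q) : c.ratio ≠ 0 :=
  div_ne_zero c.2.1 (critValue_ne_zero p q)

theorem ratio_ne_one (c : PuncturedPlane p q) : c.ratio ≠ 1 := fun h =>
  c.2.2 ((div_eq_one_iff_eq (critValue_ne_zero p q)).mp h)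

/-- The three intervals cut out on the real line by `0` and `1`. -/
def realGap : Fin 3 → Set ℝ := ![Set.Ioo 0 1, Set.Iio 0, Set.Ioi 1]

theorem isOpen_realGap (i : Fin 3) : IsOpen (realGap i) := by
  fin_cases i
  · exact isOpen_Ioo
  · exact isOpen_Iio
  · exact isOpen_Ioi

theorem realGap_disjoint {i j : Fin 3} {x : ℝ} (hi : x ∈ realGap i) (hj : x ∈ realGap j) :
    i = j := by
  fin_cases i <;> fin_cases j <;> first
    | rfl
    | (exfalso; simp [realGap] at hi hj; linarith)

/-- The plane slit along two of the three real intervals. -/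
def chart (p q : ℕ) (i : Fin 3) : Set (PuncturedPlane p q) :=
  {c | c.ratio.im ≠ 0 ∨ c.ratio.re ∈ realGap i}

theorem isOpen_chart (i : Fin 3) : IsOpen (chart p q i) :=
  (isOpen_ne.preimage (Complex.continuous_im.comp continuous_ratio)).union
    ((isOpen_realGap i).preimage (Complex.continuous_re.comp continuous_ratio))

theorem exists_mem_chart (c : PuncturedPlane p q) : ∃ i, c ∈ chart p q i := by
  by_cases him : c.ratio.im = 0
  · have h0 : c.ratio.re ≠ 0 := fun h => c.ratio_ne_zero (Complex.ext h him)
    have h1 : c.ratio.re ≠ 1 := fun h => c.ratio_ne_one (Complex.ext h him)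
    rcases lt_or_gt_of_ne h0 with h | h
    · exact ⟨1, Or.inr h⟩
    · rcases lt_or_gt_of_ne h1 with h' | h'
      · exact ⟨0, Or.inr ⟨h, h'⟩⟩
      · exact ⟨2, Or.inr h'⟩
  · exact ⟨0, Or.inl him⟩

open Classical in
/-- A chart containing a given point, the central one if possible. -/
noncomputable def chartIndex (c : PuncturedPlane p q) : Fin 3 :=
  if c ∈ chart p q 0 then 0 else (exists_mem_chart c).choose

theorem mem_chart_chartIndex (c : PuncturedPlane p q) : c ∈ chart p q c.chartIndex := by
  rw [chartIndex]
  split_ifs with h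
  · exact h
  · exact (exists_mem_chart c).choose_spec

/-- Distinct charts overlap only in the two open half planes, so the transition functions of the
covering can be locally constant. -/
theorem im_ne_zero_of_mem_chart {i j : Fin 3} {c : PuncturedPlane p q} (hi : c ∈ chart p q i)
    (hj : c ∈ chart p q j) (hij : i ≠ j) : c.ratio.im ≠ 0 := by
  rcases hi with h | hi
  · exact h
  · rcases hj with h | hj
    · exact h
    · exact absurd (realGap_disjoint hi hj) hij

/-! ### The covering with fibre the free group -/

instance : TopologicalSpace (FreeGroup (Fin 2)) := ⊥

instance : DiscreteTopology (FreeGroup (Fin 2)) := ⟨rfl⟩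

/-- Crossing the interval `i` downwards multiplies by `crossing i`. -/
def crossing : Fin 3 → FreeGroup (Fin 2) := ![1, FreeGroup.of 0, (FreeGroup.of 1)⁻¹]

open Classical in
/-- The covering of `ℂ ∖ {0, μ}` with fibre the free group of rank two, glued from
copies of the upper and of the lower half plane. -/
noncomputable def freeCover (p q : ℕ) :
    FiberBundleCore (Fin 3) (PuncturedPlane p q) (FreeGroup (Fin 2)) where
  baseSet := chart p q
  isOpen_baseSet := isOpen_chart
  indexAt := chartIndex
  mem_baseSet_at := mem_chart_chartIndex
  -- The upper half planes are glued identically and the lower ones with a twist. The real line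
  -- falls under the second branch, harmlessly: there only `i = j` occurs, and the twist is trivial.
  coordChange i j c v := if 0 < c.ratio.im then v else (crossing j)⁻¹ * crossing i * v
  coordChange_self i x _ v := by simp
  continuousOn_coordChange i j := by
    by_cases hij : i = j
    · subst hij
      simpa using continuous_snd.continuousOn
    · rintro ⟨c, v⟩ ⟨⟨hi, hj⟩, -⟩
      have hc : Continuous fun x : PuncturedPlane p q × FreeGroup (Fin 2) => x.1.ratio.im :=
        Complex.continuous_im.comp (continuous_ratio.comp continuous_fst)
      refine ContinuousAt.continuousWithinAt ?_
      rcases lt_or_gt_of_ne (im_ne_zero_of_mem_chart hi hj hij) with h | h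
      · have : ContinuousAt (fun x : PuncturedPlane p q × FreeGroup (Fin 2) =>
            (crossing j)⁻¹ * crossing i * x.2) (c, v) :=
          (continuous_of_discreteTopology.comp continuous_snd).continuousAt
        refine this.congr ?_
        filter_upwards [hc.continuousAt.eventually (gt_mem_nhds h)] with x hx
        rw [if_neg (not_lt.mpr hx.le)]
      · refine (continuous_snd.continuousAt (x := (c, v))).congr ?_
        filter_upwards [hc.continuousAt.eventually (lt_mem_nhds h)] with x hx
        rw [if_pos hx]
  coordChange_comp i j k x _ v := by
    split_ifs
    · rfl
    · group

theorem isCoveringMap_freeCover (p q : ℕ) : IsCoveringMap (freeCover p q).proj :=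
  FiberBundle.isCoveringMap (F := FreeGroup (Fin 2)) (E := (freeCover p q).Fiber)

/-- The coordinate of a point of the covering in the preferred chart. -/
noncomputable def baseSheet (e : (freeCover p q).TotalSpace) : FreeGroup (Fin 2) := e.2

/-- The coordinate of a point of the covering in a given chart. -/
noncomputable def sheet (i : Fin 3) (e : (freeCover p q).TotalSpace) : FreeGroup (Fin 2) :=
  ((freeCover p q).localTriv i e).2

theorem continuousOn_sheet (i : Fin 3) :
    ContinuousOn (sheet (p := p) (q := q) i) ((freeCover p q).proj ⁻¹' chart p q i) :=
  continuous_snd.comp_continuousOn ((freeCover p q).localTriv i).continuousOn_toFun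

/-- The coordinate in one chart is continuous with discrete values, hence constant along a connected
stretch of a lifted path. -/
theorem sheet_eq {S : Set unitInterval} (hS : S.OrdConnected)
    {Γ : C(unitInterval, (freeCover p q).TotalSpace)} {i : Fin 3}
    (h : ∀ t ∈ S, (freeCover p q).proj (Γ t) ∈ chart p q i) {s t : unitInterval}
    (hs : s ∈ S) (ht : t ∈ S) : sheet i (Γ s) = sheet i (Γ t) :=
  hS.isPreconnected.constant (f := fun t => sheet i (Γ t))
    ((continuousOn_sheet i).comp Γ.continuous.continuousOn h) hs ht

theorem sheet_of_pos {e : (freeCover p q).TotalSpace}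
    (h : 0 < ((freeCover p q).proj e).ratio.im) (i j : Fin 3) : sheet i e = sheet j e := by
  have : ∀ k, sheet k e = baseSheet e := fun k => if_pos h
  rw [this, this]

/-- In the lower half plane it is `crossing i * sheet i e` that is independent of the chart. As
`crossing 0 = 1`, a descent through the interval `i` multiplies the coordinate of chart `0` by
`crossing i`. -/
theorem sheet_of_neg {e : (freeCover p q).TotalSpace}
    (h : ((freeCover p q).proj e).ratio.im < 0) (i j : Fin 3) :
    crossing i * sheet i e = crossing j * sheet j e := by
  have : ∀ k, sheet k e = (crossing k)⁻¹ * crossing ((freeCover p q).proj e).chartIndex * baseSheet e :=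
    fun k => if_neg (not_lt.mpr h.le)
  rw [this, this]
  group

theorem midpt_ratio : (midpt p q).ratio = ((1 / 2 : ℝ) : ℂ) := by
  have := critValue_ne_zero p q
  simp only [ratio, midpt]
  push_cast
  field_simp

theorem midpt_mem_chart : midpt p q ∈ chart p q 0 := by
  refine Or.inr ?_
  rw [midpt_ratio, Complex.ofReal_re]
  norm_num [realGap]

/-- The point of the fibre over the base point with a given coordinate. -/
noncomputable def fiberPoint (p q : ℕ) (v : FreeGroup (Fin 2)) :
    (freeCover p q).proj ⁻¹' {midpt p q} :=
  ⟨⟨midpt p q, v⟩, rfl⟩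

theorem chartIndex_midpt : (midpt p q).chartIndex = 0 := if_pos midpt_mem_chart

/-- Over the base point the preferred chart is the central one, so the change of coordinates to
chart `0` is trivial. -/
theorem sheet_zero_of_proj_eq {e : (freeCover p q).TotalSpace}
    (h : (freeCover p q).proj e = midpt p q) : sheet 0 e = baseSheet e := by
  have hc : sheet 0 e = if 0 < ((freeCover p q).proj e).ratio.im then baseSheet e else
      (crossing 0)⁻¹ * crossing ((freeCover p q).proj e).chartIndex * baseSheet e := rfl
  rw [hc, h, chartIndex_midpt, inv_mul_cancel, one_mul, ite_self]

theorem fiberPoint_injective : Function.Injective (fiberPoint p q) := fun v w h => by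
  have : sheet 0 (fiberPoint p q v).1 = sheet 0 (fiberPoint p q w).1 := by rw [h]
  rwa [sheet_zero_of_proj_eq rfl, sheet_zero_of_proj_eq rfl] at this

theorem eq_fiberPoint {e : (freeCover p q).proj ⁻¹' {midpt p q}} {v : FreeGroup (Fin 2)}
    (h : sheet 0 e.1 = v) : e = fiberPoint p q v := by
  obtain ⟨⟨c, w⟩, hc⟩ := e
  have hc' : c = midpt p q := hc
  subst hc'
  rw [sheet_zero_of_proj_eq rfl] at h
  exact Subtype.ext (congrArg (fun v => (⟨midpt p q, v⟩ : (freeCover p q).TotalSpace)) h)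

/-! ### The two circles and their monodromy -/

theorem ratio_loopAroundZero (t : unitInterval) :
    (loopAroundZero p q t).ratio =
      ((Real.cos (2 * Real.pi * t) / 2 : ℝ) : ℂ) + ((Real.sin (2 * Real.pi * t) / 2 : ℝ) : ℂ) *
        Complex.I := by
  have h : (2 * Real.pi * Complex.I * (t : ℝ) : ℂ) =
      ((2 * Real.pi * (t : ℝ) : ℝ) : ℂ) * Complex.I := by
    push_cast; ring
  have hr : (loopAroundZero p q t).ratio = critValue p q / 2 *
      Complex.exp (2 * Real.pi * Complex.I * (t : ℝ)) / critValue p q := rfl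
  have := critValue_ne_zero p q
  rw [hr, h, Complex.exp_mul_I, ← Complex.ofReal_cos, ← Complex.ofReal_sin]
  push_cast
  field_simp

/-- The second circle is the first one turned by the half-turn `r ↦ 1 - r`, which exchanges the
punctures and the half planes; its position is thus read off from the first. -/
theorem ratio_loopAroundMu (t : unitInterval) :
    (loopAroundMu p q t).ratio = 1 - (loopAroundZero p q t).ratio := by
  have hr : (loopAroundMu p q t).ratio = (critValue p q - critValue p q / 2 *
      Complex.exp (2 * Real.pi * Complex.I * (t : ℝ))) / critValue p q := rfl
  have hr' : (loopAroundZero p q t).ratio = critValue p q / 2 *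
      Complex.exp (2 * Real.pi * Complex.I * (t : ℝ)) / critValue p q := rfl
  rw [hr, hr', sub_div, div_self (critValue_ne_zero p q)]

theorem im_loopAroundZero (t : unitInterval) :
    (loopAroundZero p q t).ratio.im = Real.sin (2 * Real.pi * t) / 2 := by
  simp [ratio_loopAroundZero, -Complex.ofReal_div, -Complex.ofReal_cos, -Complex.ofReal_sin]

theorem re_loopAroundZero (t : unitInterval) :
    (loopAroundZero p q t).ratio.re = Real.cos (2 * Real.pi * t) / 2 := by
  simp [ratio_loopAroundZero, -Complex.ofReal_div, -Complex.ofReal_cos, -Complex.ofReal_sin]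

theorem im_loopAroundMu (t : unitInterval) :
    (loopAroundMu p q t).ratio.im = -(loopAroundZero p q t).ratio.im := by
  simp [ratio_loopAroundMu]

theorem re_loopAroundMu (t : unitInterval) :
    (loopAroundMu p q t).ratio.re = 1 - (loopAroundZero p q t).ratio.re := by
  simp [ratio_loopAroundMu]

theorem im_loopAroundZero_pos {t : unitInterval} (h0 : 0 < (t : ℝ)) (h1 : (t : ℝ) < 1 / 2) :
    0 < (loopAroundZero p q t).ratio.im := by
  rw [im_loopAroundZero]
  exact half_pos (Real.sin_pos_of_pos_of_lt_pi (by positivity) (by nlinarith [Real.pi_pos]))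

theorem im_loopAroundZero_neg {t : unitInterval} (h0 : 1 / 2 < (t : ℝ)) (h1 : (t : ℝ) < 1) :
    (loopAroundZero p q t).ratio.im < 0 := by
  rw [im_loopAroundZero, ← Real.sin_sub_two_pi]
  exact div_neg_of_neg_of_pos (Real.sin_neg_of_neg_of_neg_pi_lt (by nlinarith [Real.pi_pos])
    (by nlinarith [Real.pi_pos])) two_pos

theorem loopAroundZero_mem_left {t : unitInterval} (h : (t : ℝ) < 1 / 2) :
    (loopAroundZero p q t).ratio.im ≠ 0 ∨ (loopAroundZero p q t).ratio.re = 1 / 2 := by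
  rcases t.2.1.eq_or_lt with h0 | h0
  · right; rw [re_loopAroundZero, ← h0]; simp
  · exact Or.inl (im_loopAroundZero_pos h0 h).ne'

theorem loopAroundZero_mem_right {t : unitInterval} (h : 1 / 2 < (t : ℝ)) :
    (loopAroundZero p q t).ratio.im ≠ 0 ∨ (loopAroundZero p q t).ratio.re = 1 / 2 := by
  rcases t.2.2.eq_or_lt with h0 | h0
  · right; rw [re_loopAroundZero, h0]; simp
  · exact Or.inl (im_loopAroundZero_neg h h0).ne

theorem loopAroundZero_mem_middle {t : unitInterval} (h0 : 0 < (t : ℝ)) (h1 : (t : ℝ) < 1) :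
    (loopAroundZero p q t).ratio.im ≠ 0 ∨ (loopAroundZero p q t).ratio.re = -(1 / 2) := by
  rcases lt_trichotomy (t : ℝ) (1 / 2) with h | h | h
  · exact Or.inl (im_loopAroundZero_pos h0 h).ne'
  · right
    rw [re_loopAroundZero, h, mul_one_div, mul_div_cancel_left₀ _ two_ne_zero, Real.cos_pi]
    norm_num
  · exact Or.inl (im_loopAroundZero_neg h h1).ne

/-- The time `1 / 4`. -/
noncomputable def quarter : unitInterval := ⟨1 / 4, by norm_num, by norm_num⟩

/-- The time `3 / 4`. -/
noncomputable def threeQuarters : unitInterval := ⟨3 / 4, by norm_num, by norm_num⟩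

/-- The sheets visited by a lift of a loop crossing from one chart to another one and back. -/
theorem sheet_lift {i : Fin 3} {Γ : C(unitInterval, (freeCover p q).TotalSpace)}
    (hl : ∀ t : unitInterval, (t : ℝ) < 1 / 2 → (freeCover p q).proj (Γ t) ∈ chart p q 0)
    (hm : ∀ t : unitInterval, 0 < (t : ℝ) → (t : ℝ) < 1 → (freeCover p q).proj (Γ t) ∈ chart p q i)
    (hr : ∀ t : unitInterval, 1 / 2 < (t : ℝ) → (freeCover p q).proj (Γ t) ∈ chart p q 0) :
    sheet 0 (Γ 0) = sheet 0 (Γ quarter) ∧ sheet i (Γ quarter) = sheet i (Γ threeQuarters) ∧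
      sheet 0 (Γ threeQuarters) = sheet 0 (Γ 1) := by
  have hq : ((quarter : unitInterval) : ℝ) = 1 / 4 := rfl
  have ht : ((threeQuarters : unitInterval) : ℝ) = 3 / 4 := rfl
  refine ⟨?_, ?_, ?_⟩
  · refine sheet_eq (S := {t | (t : ℝ) < 1 / 2}) ⟨fun x _ y hy z hz => ?_⟩ hl ?_ ?_
    · exact lt_of_le_of_lt (Subtype.coe_le_coe.mpr hz.2) hy
    · simp
    · simp only [Set.mem_ofPred_eq, hq]; norm_num
  · refine sheet_eq (S := {t | 0 < (t : ℝ) ∧ (t : ℝ) < 1}) ⟨fun x hx y hy z hz => ?_⟩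
      (fun t h => hm t h.1 h.2) ?_ ?_
    · exact ⟨lt_of_lt_of_le hx.1 (Subtype.coe_le_coe.mpr hz.1),
        lt_of_le_of_lt (Subtype.coe_le_coe.mpr hz.2) hy.2⟩
    · simp only [Set.mem_ofPred_eq, hq]; norm_num
    · simp only [Set.mem_ofPred_eq, ht]; norm_num
  · refine sheet_eq (S := {t | 1 / 2 < (t : ℝ)}) ⟨fun x hx y _ z hz => ?_⟩ hr ?_ ?_
    · exact lt_of_lt_of_le hx (Subtype.coe_le_coe.mpr hz.1)
    · simp only [Set.mem_ofPred_eq, ht]; norm_num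
    · simp only [Set.mem_ofPred_eq, Set.Icc.coe_one]; norm_num

theorem monodromy_eq_of_sheet {γ : Path (midpt p q) (midpt p q)} {v w : FreeGroup (Fin 2)}
    (h : ∀ Γ : C(unitInterval, (freeCover p q).TotalSpace),
      (∀ t, (freeCover p q).proj (Γ t) = γ t) → sheet 0 (Γ 0) = v → sheet 0 (Γ 1) = w) :
    (isCoveringMap_freeCover p q).monodromy ⟦γ⟧ (fiberPoint p q v) = fiberPoint p q w := by
  refine eq_fiberPoint (h ((isCoveringMap_freeCover p q).liftPath γ (fiberPoint p q v).1
    γ.source) (fun t => congrFun ((isCoveringMap_freeCover p q).liftPath_lifts ..) t) ?_)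
  exact (congrArg (sheet 0) ((isCoveringMap_freeCover p q).liftPath_zero ..)).trans
    (sheet_zero_of_proj_eq rfl)

/-- The circle descends through the negative axis, gaining the factor `crossing 1`, and climbs back
through the central interval, which contributes nothing. -/
theorem monodromy_loopAroundZero (v : FreeGroup (Fin 2)) :
    (isCoveringMap_freeCover p q).monodromy ⟦loopAroundZero p q⟧ (fiberPoint p q v) =
      fiberPoint p q (FreeGroup.of 0 * v) := by
  refine monodromy_eq_of_sheet fun Γ hΓ h0 => ?_
  obtain ⟨h1, h2, h3⟩ := sheet_lift (i := 1) (Γ := Γ)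
    (fun t ht => (loopAroundZero_mem_left ht).imp (by rw [hΓ]; exact id)
      (fun h => by rw [hΓ, h]; norm_num [realGap]))
    (fun t ht ht' => (loopAroundZero_mem_middle ht ht').imp (by rw [hΓ]; exact id)
      (fun h => by rw [hΓ, h]; norm_num [realGap]))
    (fun t ht => (loopAroundZero_mem_right ht).imp (by rw [hΓ]; exact id)
      (fun h => by rw [hΓ, h]; norm_num [realGap]))
  have h4 := sheet_of_pos (e := Γ quarter)
    (by rw [hΓ]; exact im_loopAroundZero_pos (by norm_num [quarter]) (by norm_num [quarter])) 0 1
  have h5 := sheet_of_neg (e := Γ threeQuarters)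
    (by rw [hΓ]
        exact im_loopAroundZero_neg (by norm_num [threeQuarters]) (by norm_num [threeQuarters])) 0 1
  rw [← h2, ← h4, ← h1, h0, h3] at h5
  simpa [crossing] using h5

/-- This circle starts in the lower half plane and climbs through the ray beyond `1`. The upward
crossing inverts `crossing 2`, which is why the latter was chosen as an inverse. -/
theorem monodromy_loopAroundMu (v : FreeGroup (Fin 2)) :
    (isCoveringMap_freeCover p q).monodromy ⟦loopAroundMu p q⟧ (fiberPoint p q v) =
      fiberPoint p q (FreeGroup.of 1 * v) := by
  refine monodromy_eq_of_sheet fun Γ hΓ h0 => ?_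
  have him : ∀ {t : unitInterval}, (loopAroundZero p q t).ratio.im ≠ 0 →
      (loopAroundMu p q t).ratio.im ≠ 0 := fun h => by rwa [im_loopAroundMu, neg_ne_zero]
  obtain ⟨h1, h2, h3⟩ := sheet_lift (i := 2) (Γ := Γ)
    (fun t ht => (loopAroundZero_mem_left ht).imp (by rw [hΓ]; exact him)
      (fun h => by rw [hΓ, re_loopAroundMu, h]; norm_num [realGap]))
    (fun t ht ht' => (loopAroundZero_mem_middle ht ht').imp (by rw [hΓ]; exact him)
      (fun h => by rw [hΓ, re_loopAroundMu, h]; simp only [realGap, Matrix.cons_val]; norm_num))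
    (fun t ht => (loopAroundZero_mem_right ht).imp (by rw [hΓ]; exact him)
      (fun h => by rw [hΓ, re_loopAroundMu, h]; norm_num [realGap]))
  have h4 := sheet_of_neg (e := Γ quarter)
    (by rw [hΓ, im_loopAroundMu, neg_lt_zero]
        exact im_loopAroundZero_pos (by norm_num [quarter]) (by norm_num [quarter])) 0 2
  have h5 := sheet_of_pos (e := Γ threeQuarters)
    (by rw [hΓ, im_loopAroundMu, neg_pos]
        exact im_loopAroundZero_neg (by norm_num [threeQuarters]) (by norm_num [threeQuarters])) 0 2
  rw [h2, ← h5, ← h1, h0, h3] at h4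
  simp only [crossing, Matrix.cons_val, one_mul] at h4
  rw [h4, mul_inv_cancel_left]

/-- The homomorphism from the free group to the fundamental group of `ℂ ∖ {0, μ}` given by the
two circular loops. -/
noncomputable def freeToFundamentalGroup (p q : ℕ) :
    FreeGroup (Fin 2) →* FundamentalGroup (PuncturedPlane p q) (midpt p q) :=
  FreeGroup.lift ![FundamentalGroup.fromPath ⟦loopAroundZero p q⟧,
    FundamentalGroup.fromPath ⟦loopAroundMu p q⟧]

theorem monodromyPerm_freeToFundamentalGroup (w : FreeGroup (Fin 2)) :
    ∀ v, (isCoveringMap_freeCover p q).monodromyPerm (midpt p q) (freeToFundamentalGroup p q w)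
      (fiberPoint p q v) = fiberPoint p q (w * v) := by
  have h0 : freeToFundamentalGroup p q (FreeGroup.of 0) =
      FundamentalGroup.fromPath ⟦loopAroundZero p q⟧ := FreeGroup.lift_apply_of
  have h1 : freeToFundamentalGroup p q (FreeGroup.of 1) =
      FundamentalGroup.fromPath ⟦loopAroundMu p q⟧ := FreeGroup.lift_apply_of
  induction w with
  | C1 => intro v; rw [map_one, map_one, one_mul]; rfl
  | of i =>
    intro v
    match i with
    | 0 => rw [h0]; exact monodromy_loopAroundZero v
    | 1 => rw [h1]; exact monodromy_loopAroundMu v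
  | inv_of i ih =>
    intro v
    rw [map_inv, map_inv, Equiv.Perm.inv_eq_iff_eq, ih, mul_inv_cancel_left]
  | mul x y hx hy =>
    intro v
    rw [map_mul, map_mul, Equiv.Perm.mul_apply, hy, hx, mul_assoc]

theorem freeToFundamentalGroup_injective (p q : ℕ) :
    Function.Injective (freeToFundamentalGroup p q) := by
  rw [injective_iff_map_eq_one]
  intro w hw
  have h := monodromyPerm_freeToFundamentalGroup (p := p) (q := q) w 1
  rw [hw, map_one, Equiv.Perm.one_apply, mul_one] at h
  exact (fiberPoint_injective h).symm

end PuncturedPlane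

/-! ### Leading coefficients and power sums -/

/-- The three leading coefficients of a monic polynomial of degree `k`, multiplied by `X ^ 2`, in
terms of the first two power sums `s`, `t` of its roots. -/
structure LeadingPowerSums (Q : ℂ[X]) (k : ℕ) (s t : ℂ) : Prop where
  coeff_gt : ∀ j, k + 2 < j → Q.coeff j = 0
  coeff_top : Q.coeff (k + 2) = 1
  coeff_next : Q.coeff (k + 1) = -s
  coeff_third : 2 * Q.coeff k = s ^ 2 - t

/-- By Newton's identity the third coefficient is `e₂ = (s² - t) / 2`, and a new root `c` adds `c s`
to it. The factor `X ^ 2` keeps the indices from being truncated when there are fewer than two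
roots. -/
theorem LeadingPowerSums.mul_X_sub_C {Q : ℂ[X]} {k : ℕ} {s t : ℂ} (h : LeadingPowerSums Q k s t)
    (c : ℂ) : LeadingPowerSums (Q * (X - C c)) (k + 1) (s + c) (t + c ^ 2) where
  coeff_gt j hj := by
    obtain ⟨j, rfl⟩ : ∃ i, j = i + 1 := ⟨j - 1, by omega⟩
    rw [coeff_mul_X_sub_C, h.coeff_gt j (by omega), h.coeff_gt (j + 1) (by omega)]
    ring
  coeff_top := by
    rw [coeff_mul_X_sub_C, h.coeff_gt (k + 1 + 1 + 1) (by omega), h.coeff_top]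
    ring
  coeff_next := by
    rw [coeff_mul_X_sub_C, h.coeff_next, h.coeff_top]
    ring
  coeff_third := by
    rw [coeff_mul_X_sub_C, mul_sub, h.coeff_third, h.coeff_next]
    ring

theorem LeadingPowerSums.mul_X_sub_C_pow {Q : ℂ[X]} {k : ℕ} {s t : ℂ}
    (h : LeadingPowerSums Q k s t) (c : ℂ) (m : ℕ) :
    LeadingPowerSums (Q * (X - C c) ^ m) (k + m) (s + m * c) (t + m * c ^ 2) := by
  induction m with
  | zero => simpa using h
  | succ m ih =>
    convert ih.mul_X_sub_C c using 1
    · rw [pow_succ, mul_assoc]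
    · rw [add_assoc]
    · push_cast; ring
    · push_cast; ring

theorem leadingPowerSums_X_sq : LeadingPowerSums (X ^ 2) 0 0 0 where
  coeff_gt j hj := by rw [coeff_X_pow, if_neg (by omega)]
  coeff_top := by simp [coeff_X_pow]
  coeff_next := by simp [coeff_X_pow]
  coeff_third := by simp [coeff_X_pow]

theorem leadingPowerSums_two_roots (p q : ℕ) (a b : ℂ) :
    LeadingPowerSums (X ^ 2 * ((X - C a) ^ p * (X - C b) ^ q)) (p + q) (p * a + q * b)
      (p * a ^ 2 + q * b ^ 2) := by
  have h := (leadingPowerSums_X_sq.mul_X_sub_C_pow a p).mul_X_sub_C_pow b q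
  rw [mul_assoc] at h
  simpa using h

/-! ### Continuous invariants of the critical points -/

namespace PolyStratum

variable {p q : ℕ}

/-- `a`, `b` are the critical points of `f`, of multiplicities `p` and `q`. -/
def IsCritical (f : PolyStratum p q) (a b : ℂ) : Prop :=
  derivative f.1 = C ((p + q + 1 : ℕ) : ℂ) * ((X - C a) ^ p * (X - C b) ^ q)

/-- The sum of the critical points with multiplicity. -/
noncomputable def critSum (f : PolyStratum p q) : ℂ :=
  -(X ^ 2 * derivative f.1).coeff (p + q + 1) / ((p + q + 1 : ℕ) : ℂ)

/-- The square of the difference of the two critical points. -/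
noncomputable def critDisc (f : PolyStratum p q) : ℂ :=
  ((p + q) * (f.critSum ^ 2 - 2 * ((X ^ 2 * derivative f.1).coeff (p + q) /
    ((p + q + 1 : ℕ) : ℂ))) - f.critSum ^ 2) / (p * q)

theorem IsCritical.critSum_eq {f : PolyStratum p q} {a b : ℂ} (h : f.IsCritical a b) :
    f.critSum = p * a + q * b := by
  have hn : ((p + q + 1 : ℕ) : ℂ) ≠ 0 := Nat.cast_ne_zero.mpr (Nat.succ_ne_zero _)
  rw [critSum, h, mul_left_comm, coeff_C_mul, (leadingPowerSums_two_roots p q a b).coeff_next]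
  field_simp

/-- This is `(p + q)(p a² + q b²) - (p a + q b)² = p q (b - a)²`. -/
theorem IsCritical.critDisc_eq {f : PolyStratum p q} {a b : ℂ} (h : f.IsCritical a b)
    (hp : p ≠ 0) (hq : q ≠ 0) : f.critDisc = (b - a) ^ 2 := by
  have hn : ((p + q + 1 : ℕ) : ℂ) ≠ 0 := Nat.cast_ne_zero.mpr (Nat.succ_ne_zero _)
  have hp' : (p : ℂ) ≠ 0 := Nat.cast_ne_zero.mpr hp
  have hq' : (q : ℂ) ≠ 0 := Nat.cast_ne_zero.mpr hq
  rw [critDisc, h.critSum_eq, h, mul_left_comm, coeff_C_mul, mul_div_cancel_left₀ _ hn,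
    (leadingPowerSums_two_roots p q a b).coeff_third]
  field_simp
  ring

theorem exists_isCritical (f : PolyStratum p q) : ∃ a b : ℂ, a ≠ b ∧ f.IsCritical a b :=
  f.2.2.2.2

theorem critDisc_ne_zero (hp : p ≠ 0) (hq : q ≠ 0) (f : PolyStratum p q) : f.critDisc ≠ 0 := by
  obtain ⟨a, b, hab, h⟩ := f.exists_isCritical
  rw [h.critDisc_eq hp hq]
  exact pow_ne_zero 2 (sub_ne_zero.mpr hab.symm)

theorem continuous_coeff (k : ℕ) : Continuous fun f : PolyStratum p q => f.1.coeff k := by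
  rcases lt_trichotomy k (p + q + 1) with h | h | h
  · have h1 : Continuous fun (f : PolyStratum p q) (i : Fin (p + q + 1)) => f.1.coeff i :=
      continuous_induced_dom
    exact continuous_pi_iff.mp h1 ⟨k, h⟩
  · have : (fun f : PolyStratum p q => f.1.coeff k) = fun _ => 1 := funext fun f => by
      rw [h]
      exact (congrArg f.1.coeff f.2.2.1).symm.trans f.2.1
    rw [this]
    exact continuous_const
  · have : (fun f : PolyStratum p q => f.1.coeff k) = fun _ => 0 := funext fun f =>
      coeff_eq_zero_of_natDegree_lt (by rw [f.2.2.1]; exact h)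
    rw [this]
    exact continuous_const

theorem continuous_coeff_derivative (k : ℕ) :
    Continuous fun f : PolyStratum p q => (derivative f.1).coeff k := by
  simp only [coeff_derivative]
  exact (continuous_coeff _).mul continuous_const

theorem continuous_coeff_X_sq_mul_derivative (k : ℕ) :
    Continuous fun f : PolyStratum p q => (X ^ 2 * derivative f.1).coeff k := by
  simp only [coeff_X_pow_mul']
  split_ifs
  · exact continuous_coeff_derivative _
  · exact continuous_const

theorem continuous_critSum : Continuous (critSum : PolyStratum p q → ℂ) :=
  (continuous_coeff_X_sq_mul_derivative _).neg.div_const _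

theorem continuous_critDisc : Continuous (critDisc : PolyStratum p q → ℂ) := by
  have h1 := continuous_critSum (p := p) (q := q)
  have h2 := continuous_coeff_X_sq_mul_derivative (p := p) (q := q) (p + q)
  unfold critDisc
  fun_prop

theorem continuous_eval {A : Type*} [TopologicalSpace A] {F : A → PolyStratum p q} {z : A → ℂ}
    (hF : Continuous F) (hz : Continuous z) : Continuous fun t => (F t).1.eval (z t) := by
  have h : ∀ t, (F t).1.eval (z t) =
      ∑ i ∈ Finset.range (p + q + 2), (F t).1.coeff i * z t ^ i := fun t =>
    eval_eq_sum_range' (by rw [(F t).2.2.1]; omega) _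
  simp only [h]
  exact continuous_finsetSum _ fun i _ => ((continuous_coeff i).comp hF).mul (hz.pow i)

theorem continuous_eval_derivative {A : Type*} [TopologicalSpace A] {F : A → PolyStratum p q}
    (hF : Continuous F) (z : ℂ) : Continuous fun t => (derivative (F t).1).eval z := by
  have h : ∀ t, (derivative (F t).1).eval z =
      ∑ i ∈ Finset.range (p + q + 2), (derivative (F t).1).coeff i * z ^ i := fun t =>
    eval_eq_sum_range' ((natDegree_derivative_le _).trans_lt (by rw [(F t).2.2.1]; omega)) _
  simp only [h]
  exact continuous_finsetSum _ fun i _ =>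
    ((continuous_coeff_derivative i).comp hF).mul continuous_const

/-! ### Choosing the order of the critical points -/

/-- The critical point of multiplicity `p`, if `d` is the difference of the critical points. -/
noncomputable def firstCrit (f : PolyStratum p q) (d : ℂ) : ℂ := (f.critSum - q * d) / (p + q)

/-- The critical point of multiplicity `q`, if `d` is the difference of the critical points. -/
noncomputable def secondCrit (f : PolyStratum p q) (d : ℂ) : ℂ := (f.critSum + p * d) / (p + q)

theorem cast_add_ne_zero (hp : p ≠ 0) : (p : ℂ) + q ≠ 0 := by
  exact_mod_cast (by omega : p + q ≠ 0)

theorem secondCrit_sub_firstCrit (hp : p ≠ 0) (f : PolyStratum p q) (d : ℂ) :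
    f.secondCrit d - f.firstCrit d = d := by
  have := cast_add_ne_zero (q := q) hp
  rw [secondCrit, firstCrit]
  field_simp
  ring

theorem IsCritical.firstCrit_eq (hp : p ≠ 0) {f : PolyStratum p q} {a b : ℂ}
    (h : f.IsCritical a b) : f.firstCrit (b - a) = a := by
  have := cast_add_ne_zero (q := q) hp
  rw [firstCrit, h.critSum_eq]
  field_simp
  ring

theorem IsCritical.secondCrit_eq (hp : p ≠ 0) {f : PolyStratum p q} {a b : ℂ}
    (h : f.IsCritical a b) : f.secondCrit (b - a) = b := by
  have := cast_add_ne_zero (q := q) hp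
  rw [secondCrit, h.critSum_eq]
  field_simp
  ring

/-- `d` is the difference of the critical points of `f`. -/
def IsGap (f : PolyStratum p q) (d : ℂ) : Prop := f.IsCritical (f.firstCrit d) (f.secondCrit d)

theorem isGap_or_isGap_neg (hp : p ≠ 0) (hq : q ≠ 0) {f : PolyStratum p q} {d : ℂ}
    (hd : d ^ 2 = f.critDisc) : f.IsGap d ∨ f.IsGap (-d) := by
  obtain ⟨a, b, -, h⟩ := f.exists_isCritical
  have h' : f.IsGap (b - a) := by
    rw [IsGap, h.firstCrit_eq hp, h.secondCrit_eq hp]; exact h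
  rw [h.critDisc_eq hp hq] at hd
  rcases sq_eq_sq_iff_eq_or_eq_neg.mp hd with rfl | rfl
  · exact Or.inl h'
  · exact Or.inr (by rwa [neg_neg])

/-- The first critical point for `d` must be a root of the factorization for `-d`. Agreement with
its first root forces `q d = 0`, and agreement with its second forces `(p - q) d = 0`. -/
theorem multiplicities_eq_of_isGap_neg (hp : p ≠ 0) (hq : q ≠ 0) {f : PolyStratum p q} {d : ℂ} (hd : d ≠ 0)
    (h : f.IsGap d) (h' : f.IsGap (-d)) : p = q := by
  have hN := cast_add_ne_zero (q := q) hp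
  have hn : ((p + q + 1 : ℕ) : ℂ) ≠ 0 := Nat.cast_ne_zero.mpr (Nat.succ_ne_zero _)
  have he := congrArg (eval (f.firstCrit d)) ((show derivative f.1 = _ from h).symm.trans h')
  simp only [eval_mul, eval_C, eval_pow, eval_sub, eval_X, sub_self, zero_pow hp, zero_mul,
    mul_zero] at he
  rcases mul_eq_zero.mp ((mul_eq_zero.mp he.symm).resolve_left hn) with h1 | h1
  · have h2 := eq_zero_of_pow_eq_zero h1
    rw [firstCrit, firstCrit, ← sub_div, div_eq_zero_iff, or_iff_left hN] at h2
    have h3 : (q : ℂ) * d = 0 := by linear_combination (-1 / 2) * h2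
    exact absurd h3 (mul_ne_zero (Nat.cast_ne_zero.mpr hq) hd)
  · have h2 := eq_zero_of_pow_eq_zero h1
    rw [firstCrit, secondCrit, ← sub_div, div_eq_zero_iff, or_iff_left hN] at h2
    have h3 : ((p : ℂ) - q) * d = 0 := by linear_combination h2
    exact_mod_cast sub_eq_zero.mp ((mul_eq_zero.mp h3).resolve_right hd)

theorem IsGap.neg_of_eq (hpq : p = q) {f : PolyStratum p q} {d : ℂ}
    (h : f.IsGap d) : f.IsGap (-d) := by
  subst hpq
  have h1 : f.firstCrit (-d) = f.secondCrit d := by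
    rw [firstCrit, secondCrit]; ring
  have h2 : f.secondCrit (-d) = f.firstCrit d := by
    rw [firstCrit, secondCrit]; ring
  rw [IsGap, h1, h2, IsCritical, show derivative f.1 = _ from h, mul_comm ((X - C _) ^ p)]

/-- An identity of polynomials is tested by evaluation at every `z`, and each evaluation is a closed
condition. -/
theorem isClosed_isGap {A : Type*} [TopologicalSpace A] {F : A → PolyStratum p q} {d : A → ℂ}
    (hF : Continuous F) (hd : Continuous d) : IsClosed {t | (F t).IsGap (d t)} := by
  have hs := continuous_critSum.comp hF
  have h : {t | (F t).IsGap (d t)} = ⋂ z : ℂ, {t | (derivative (F t).1).eval z =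
      ((p + q + 1 : ℕ) : ℂ) * ((z - (F t).firstCrit (d t)) ^ p *
        (z - (F t).secondCrit (d t)) ^ q)} := by
    ext t
    simp only [Set.mem_iInter, Set.mem_ofPred_eq]
    constructor
    · intro h z
      rw [show derivative (F t).1 = _ from h]
      simp
    · intro h
      refine Polynomial.funext fun z => ?_
      rw [h]
      simp
  rw [h]
  refine isClosed_iInter fun z => isClosed_eq (continuous_eval_derivative hF z) ?_
  simp only [firstCrit, secondCrit]
  fun_prop

/-- A continuous square root of the discriminant that is once the difference of the critical points
is always so. -/
theorem isGap_of_connected {A : Type*} [TopologicalSpace A] [PreconnectedSpace A] (hp : p ≠ 0)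
    (hq : q ≠ 0) {F : A → PolyStratum p q} {d : A → ℂ} (hF : Continuous F) (hd : Continuous d)
    (hsq : ∀ t, d t ^ 2 = (F t).critDisc) {t₀ : A} (h₀ : (F t₀).IsGap (d t₀)) (t : A) :
    (F t).IsGap (d t) := by
  by_cases hpq : p = q
  -- For equal multiplicities both signs of `d` are admissible. Otherwise the two signs define
  -- disjoint closed sets covering a connected space.
  · rcases isGap_or_isGap_neg hp hq (hsq t) with h | h
    · exact h
    · have := h.neg_of_eq hpq
      rwa [neg_neg] at this
  · by_contra ht
    obtain ⟨s, -, h1, h2⟩ := isPreconnected_closed_iff.mp (isPreconnected_univ (α := A))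
      _ _ (isClosed_isGap hF hd) (isClosed_isGap hF hd.neg)
      (fun t _ => isGap_or_isGap_neg hp hq (hsq t)) ⟨t₀, trivial, h₀⟩
      ⟨t, trivial, (isGap_or_isGap_neg hp hq (hsq t)).resolve_left ht⟩
    refine hpq (multiplicities_eq_of_isGap_neg hp hq (fun h => critDisc_ne_zero hp hq (F s) ?_) h1 h2)
    rw [← hsq, h]
    simp

/-! ### Critical values and affine normalization -/

theorem eval_ne_zero_of_eval_derivative_eq_zero (f : PolyStratum p q) {z : ℂ}
    (h : (derivative f.1).eval z = 0) : f.1.eval z ≠ 0 := by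
  obtain ⟨u, v, huv⟩ := PerfectField.separable_iff_squarefree.mpr f.2.2.2.1
  intro h0
  have := congrArg (eval z) huv
  simp [h, h0] at this

theorem IsCritical.eval_first_ne_zero (hp : p ≠ 0) {f : PolyStratum p q} {a b : ℂ}
    (h : f.IsCritical a b) : f.1.eval a ≠ 0 :=
  f.eval_ne_zero_of_eval_derivative_eq_zero (by rw [h]; simp [hp])

theorem IsCritical.eval_second_ne_zero (hq : q ≠ 0) {f : PolyStratum p q} {a b : ℂ}
    (h : f.IsCritical a b) : f.1.eval b ≠ 0 :=
  f.eval_ne_zero_of_eval_derivative_eq_zero (by rw [h]; simp [hq])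

/-- The difference of the critical values. -/
theorem IsCritical.eval_sub_eval {f : PolyStratum p q} {a b : ℂ} (h : f.IsCritical a b) :
    f.1.eval b - f.1.eval a = (b - a) ^ (p + q + 1) * critValue p q := by
  -- After moving `a`, `b` to `0`, `1`, the polynomial `f` and the rescaled base polynomial have the
  -- same derivative; their constant difference is compared at `0` and `1`.
  set g : ℂ[X] := f.1.comp (C (b - a) * X + C a) - C ((b - a) ^ (p + q + 1)) * basePoly p q with hg
  have hd : derivative g = 0 := by
    rw [hg, derivative_sub, derivative_comp, h, derivative_C_mul, derivative_basePoly, baseDeriv]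
    refine Polynomial.funext fun z => ?_
    simp only [derivative_add, derivative_C, derivative_mul, derivative_X, eval_sub, eval_mul,
      eval_add, eval_C, eval_comp, eval_pow, eval_X, eval_zero, eval_one]
    rw [show (b - a) * z + a - a = (b - a) * z by ring,
      show (b - a) * z + a - b = (b - a) * (z - 1) by ring, mul_pow, mul_pow]
    ring
  have hc := eq_C_of_natDegree_eq_zero (derivative_eq_zero.mp hd)
  have h01 : g.eval 1 = g.eval 0 := by rw [hc]; simp
  simp only [hg, eval_sub, eval_comp, eval_add, eval_mul, eval_C, eval_X, mul_one, mul_zero,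
    sub_add_cancel, zero_add, basePoly_eval_zero, basePoly_eval_one, sub_zero] at h01
  linear_combination h01

/-- The point `c` such that `f` is affinely conjugate to `f(z) - c`. -/
noncomputable def normalizedValue (f : PolyStratum p q) (d : ℂ) : ℂ :=
  -f.1.eval (f.firstCrit d) / d ^ (p + q + 1)

/-- The value `0` would make the first critical point a root of `f`, and the value `μ` the second
one; a square-free polynomial allows neither. -/
theorem IsGap.normalizedValue_ne (hp : p ≠ 0) (hq : q ≠ 0) {f : PolyStratum p q} {d : ℂ}
    (h : f.IsGap d) (hd : d ≠ 0) :
    f.normalizedValue d ≠ 0 ∧ f.normalizedValue d ≠ critValue p q := by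
  have hd' := pow_ne_zero (p + q + 1) hd
  refine ⟨div_ne_zero (neg_ne_zero.mpr (h.eval_first_ne_zero hp)) hd', fun hc => ?_⟩
  refine h.eval_second_ne_zero hq ?_
  have h1 := h.eval_sub_eval
  rw [secondCrit_sub_firstCrit hp] at h1
  rw [normalizedValue, div_eq_iff hd'] at hc
  linear_combination h1 - hc

theorem isCritical_shiftedPoly (c : PuncturedPlane p q) : (shiftedPoly p q c).IsCritical 0 1 := by
  rw [IsCritical, shiftedPoly, derivative_sub, derivative_C, sub_zero, derivative_basePoly,
    baseDeriv]

theorem critDisc_shiftedPoly (hp : p ≠ 0) (hq : q ≠ 0) (c : PuncturedPlane p q) :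
    (shiftedPoly p q c).critDisc = 1 := by
  rw [(isCritical_shiftedPoly c).critDisc_eq hp hq]; norm_num

theorem firstCrit_shiftedPoly (hp : p ≠ 0) (c : PuncturedPlane p q) :
    (shiftedPoly p q c).firstCrit 1 = 0 := by
  simpa using (isCritical_shiftedPoly c).firstCrit_eq hp

theorem secondCrit_shiftedPoly (hp : p ≠ 0) (c : PuncturedPlane p q) :
    (shiftedPoly p q c).secondCrit 1 = 1 := by
  simpa using (isCritical_shiftedPoly c).secondCrit_eq hp

theorem isGap_shiftedPoly (hp : p ≠ 0) (c : PuncturedPlane p q) : (shiftedPoly p q c).IsGap 1 := by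
  rw [IsGap, firstCrit_shiftedPoly hp, secondCrit_shiftedPoly hp]
  exact isCritical_shiftedPoly c

theorem normalizedValue_shiftedPoly (hp : p ≠ 0) (c : PuncturedPlane p q) :
    (shiftedPoly p q c).normalizedValue 1 = c.1 := by
  rw [normalizedValue, firstCrit_shiftedPoly hp]
  simp [shiftedPoly, basePoly_eval_zero]

/-! ### Descending homotopies to the punctured plane -/

open unitInterval in
/-- A homotopy of polynomials starting from polynomials `f(z) - c` has a continuous choice of the
difference of the critical points. -/
theorem exists_gap_lift {A : Type*} [TopologicalSpace A] [PreconnectedSpace A] [Nonempty A]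
    (hp : p ≠ 0) (hq : q ≠ 0) (F : C(I × A, PolyStratum p q)) {c : A → PuncturedPlane p q}
    (hc : ∀ s, F (0, s) = shiftedPoly p q (c s)) :
    ∃ d : C(I × A, ℂ), (∀ s, d (0, s) = 1) ∧ (∀ t, d t ^ 2 = (F t).critDisc) ∧
      (∀ t, (F t).IsGap (d t)) := by
  have cov := isCoveringMap_npow (𝕜 := ℂ) 2 two_ne_zero
  let H : C(I × A, {z : ℂ // z ≠ 0}) :=
    ⟨fun t => ⟨(F t).critDisc, critDisc_ne_zero hp hq _⟩,
      (continuous_critDisc.comp F.continuous).subtype_mk _⟩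
  have H₀ : ∀ s, H (0, s) = ⟨(1 : ℂ) ^ 2, pow_ne_zero 2 one_ne_zero⟩ := fun s =>
    Subtype.ext (by simp [H, hc, critDisc_shiftedPoly hp hq])
  let G := cov.liftHomotopy H (.const A ⟨1, one_ne_zero⟩) H₀
  have hG : ∀ s, (G (0, s)).1 = 1 := fun s =>
    congrArg Subtype.val (cov.liftHomotopy_zero H (.const A ⟨1, one_ne_zero⟩) H₀ s)
  have hsq : ∀ t, (G t).1 ^ 2 = (F t).critDisc := fun t =>
    congrArg Subtype.val (congrFun (cov.liftHomotopy_lifts H (.const A ⟨1, one_ne_zero⟩) H₀) t)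
  have hGc : Continuous fun t => (G t).1 := continuous_subtype_val.comp G.continuous
  refine ⟨⟨fun t => (G t).1, hGc⟩, hG, hsq, fun t => ?_⟩
  obtain ⟨s⟩ := ‹Nonempty A›
  refine isGap_of_connected hp hq F.continuous hGc hsq (t₀ := (0, s)) ?_ t
  rw [hG, hc]
  exact isGap_shiftedPoly hp _

theorem eq_one_of_critDisc_eq_one {d : unitInterval → ℂ} (hd : Continuous d)
    (h : ∀ t, d t ^ 2 = 1) {t₀ : unitInterval} (h₀ : d t₀ = 1) (t : unitInterval) : d t = 1 :=
  isPreconnected_univ.eq_of_sq_eq (f := d) (g := 1) hd.continuousOn continuousOn_const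
    (fun s _ => by simp [h]) (fun _ => one_ne_zero) (Set.mem_univ t₀) h₀ (Set.mem_univ t)

open unitInterval in
/-- Paths of polynomials `f(z) - c` are homotopic only if the paths of the constants `c` are. -/
theorem homotopic_of_map_shiftedPoly (hp : p ≠ 0) (hq : q ≠ 0) {c₀ c₁ : PuncturedPlane p q}
    {γ γ' : Path c₀ c₁} (h : (γ.map (continuous_shiftedPoly p q)).Homotopic
      (γ'.map (continuous_shiftedPoly p q))) : γ.Homotopic γ' := by
  obtain ⟨F⟩ := h
  have hF₀ : ∀ s, F (0, s) = shiftedPoly p q (γ s) := fun s => F.apply_zero s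
  have hF₁ : ∀ s, F (1, s) = shiftedPoly p q (γ' s) := fun s => F.apply_one s
  have hFl : ∀ t, F (t, 0) = shiftedPoly p q c₀ := fun t => Path.Homotopy.source F t
  have hFr : ∀ t, F (t, 1) = shiftedPoly p q c₁ := fun t => Path.Homotopy.target F t
  obtain ⟨d, hd₀, hsq, hgap⟩ := exists_gap_lift hp hq F.toContinuousMap hF₀
  change ∀ t, d t ^ 2 = (F t).critDisc at hsq
  change ∀ t, (F t).IsGap (d t) at hgap
  -- On every side of the square the polynomials have discriminant `1`, so `d` is constantly `1` or
  -- `-1` there. The value `1` spreads from the initial edge to the two adjacent sides, and from a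
  -- corner to the final edge.
  have hdl : ∀ t, d (t, 0) = 1 := eq_one_of_critDisc_eq_one (by fun_prop)
    (fun t => by rw [hsq, hFl, critDisc_shiftedPoly hp hq]) (hd₀ 0)
  have hdr : ∀ t, d (t, 1) = 1 := eq_one_of_critDisc_eq_one (by fun_prop)
    (fun t => by rw [hsq, hFr, critDisc_shiftedPoly hp hq]) (hd₀ 1)
  have hd₁ : ∀ s, d (1, s) = 1 := eq_one_of_critDisc_eq_one (by fun_prop)
    (fun s => by rw [hsq, hF₁, critDisc_shiftedPoly hp hq]) (hdl 1)
  have hd : ∀ t, d t ≠ 0 := fun t h0 => critDisc_ne_zero hp hq (F t) (by rw [← hsq, h0]; simp)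
  have hcont : Continuous fun t => (F t).normalizedValue (d t) := by
    have hs : Continuous fun t => (F t).critSum := continuous_critSum.comp F.continuous
    refine (continuous_eval F.continuous ?_).neg.div (by fun_prop) fun t => pow_ne_zero _ (hd t)
    simp only [firstCrit]
    fun_prop
  -- With `d = 1` on the boundary, `K` recovers `c` from `f - c` there, so it is a homotopy with
  -- fixed endpoints.
  let K : I × I → PuncturedPlane p q := fun t =>
    ⟨(F t).normalizedValue (d t), (hgap t).normalizedValue_ne hp hq (hd t)⟩
  have hK : ∀ {t c}, F t = shiftedPoly p q c → d t = 1 → K t = c := fun h1 h2 =>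
    Subtype.ext (by simp only [K]; rw [h1, h2, normalizedValue_shiftedPoly hp])
  refine ⟨⟨⟨⟨K, hcont.subtype_mk _⟩, fun s => hK (hF₀ s) (hd₀ s), fun s => hK (hF₁ s) (hd₁ s)⟩, ?_⟩⟩
  rintro t s (rfl | rfl)
  · exact (hK (hFl t) (hdl t)).trans γ.source.symm
  · exact (hK (hFr t) (hdr t)).trans γ.target.symm

end PolyStratum

/-! ### Injectivity on fundamental groups and freeness -/

theorem map_shiftedPoly_injective {p q : ℕ} (hp : p ≠ 0) (hq : q ≠ 0) (c : PuncturedPlane p q) :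
    Function.Injective (FundamentalGroup.map ⟨shiftedPoly p q, continuous_shiftedPoly p q⟩ c) := by
  rintro ⟨γ⟩ ⟨γ'⟩ h
  exact Quotient.sound (PolyStratum.homotopic_of_map_shiftedPoly hp hq (Quotient.exact h))

theorem mainTheorem4 (p q : ℕ) (hp : 1 ≤ p) (hq : 1 ≤ q) :
    ∃ e : FreeGroup (Fin 2) ≃*
        Subgroup.closure ({elemX p q, elemY p q} : Set (StratumBraidGroup p q)),
      (e (FreeGroup.of 0) : StratumBraidGroup p q) = elemX p q ∧
      (e (FreeGroup.of 1) : StratumBraidGroup p q) = elemY p q := by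
  let φ : FreeGroup (Fin 2) →* StratumBraidGroup p q := FreeGroup.lift ![elemX p q, elemY p q]
  have hφ : φ = (FundamentalGroup.map ⟨shiftedPoly p q, continuous_shiftedPoly p q⟩
      (midpt p q)).comp (PuncturedPlane.freeToFundamentalGroup p q) := by
    refine FreeGroup.ext_hom _ _ fun i => ?_
    rw [MonoidHom.comp_apply, PuncturedPlane.freeToFundamentalGroup]
    match i with
    | 0 => simp only [φ, FreeGroup.lift_apply_of]; rfl
    | 1 => simp only [φ, FreeGroup.lift_apply_of]; rfl
  have hinj : Function.Injective φ := by
    rw [hφ]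
    exact (map_shiftedPoly_injective (by omega) (by omega) _).comp
      (PuncturedPlane.freeToFundamentalGroup_injective p q)
  have hrange : φ.range = Subgroup.closure {elemX p q, elemY p q} := by
    rw [FreeGroup.range_lift_eq_closure]
    congr 1
    simp [Set.pair_comm]
  exact ⟨(φ.ofInjective hinj).trans (MulEquiv.subgroupCongr hrange),
    FreeGroup.lift_apply_of (f := ![elemX p q, elemY p q]) (x := 0),
    FreeGroup.lift_apply_of (f := ![elemX p q, elemY p q]) (x := 1)⟩
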